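/- Let $\mathbb{D}=\{z\in\mathbb{C}:|z|<1\}$, $\mathbb{T}=\{z\in\mathbb{C}:|z|=1\}$ and $\mathbb{E}=\{z\in\mathbb{C}:|z|>1\}$. A non-empty set $V$ is a distinguished variety if $V=\{(z,w)\in\mathbb{D}^2: p(z,w)=0\}$ for some $p\in\mathbb{C}[z,w]$ and $\overline{V}\cap\partial(\mathbb{D}^2)=\overline{V}\cap\mathbb{T}^2$. A polynomial has degree $(n,m)$ if it has degree $n$ in $z$ and $m$ in $w$. A polynomial $p$ of degree $(n,m)$ is called a minimal defining polynomial of $V$ if $V=\{(z,w)\in\mathbb{D}^2:p(z,w)=0\}$ and every polynomial $q$ of degree $(n',m')$ with $V=\{(z,w)\in\mathbb{D}^2:q(z,w)=0\}$, $n'\le n$ and $m'\le m$ satisfies $(n',m')=(n,m)$. For $p$ of degree $(n,m)$, let $\tilde p$ be the polynomial with $\tilde p(z,w)=z^n w^m\,\overline{p(1/\bar z,1/\bar w)}$ for $z,w\neq 0$. (1) Let $V$ be a distinguished variety, $p$ a minimal defining polynomial of $V$, and $V'=\{(z,w)\in\mathbb{C}^2:p(z,w)=0\}$. Then for all $z\ne0$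 and $w\neq 0$, $$(z,w)\in V' \iff \left(\frac1{\bar z},\frac1{\bar w}\right)\in V',$$ and $p$ is essentially $\mathbb{T}^2$-symmetric, that is, $p=c\,\tilde p$ for some constant $c$ with $|c|=1$. (2) Both conclusions (with $V'$ the zero set of $p$ in $\mathbb{C}^2$) also hold for every polynomial $p\in\mathbb{C}[z,w]$ whose zero set in $\mathbb{C}^2$ is contained in $\mathbb{D}^2\cup\mathbb{T}^2\cup\mathbb{E}^2$. -/

import Mathlib

open scoped ComplexConjugate

namespace DistVar

/-- The open unit disk in the complex plane. -/
def disk : Set ℂ := {z | ‖z‖ < 1}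

/-- The unit circle. -/
def circle : Set ℂ := {z | ‖z‖ = 1}

/-- The exterior of the closed unit disk. -/
def exterior : Set ℂ := {z | 1 < ‖z‖}

/-- The open bidisk. -/
def bidisk : Set (ℂ × ℂ) := disk ×ˢ disk

/-- The two-torus, which is the distinguished boundary of the bidisk. -/
def torus : Set (ℂ × ℂ) := circle ×ˢ circle

/-- The product of the exterior of the closed unit disk with itself. -/
def biexterior : Set (ℂ × ℂ) := exterior ×ˢ exterior

/-- The zero set in `ℂ²` of a polynomial in two variables; `X 0` is `z` and `X 1` is `w`. -/
def zeroSet (p : MvPolynomial (Fin 2) ℂ) : Set (ℂ × ℂ) :=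
  {x | MvPolynomial.eval ![x.1, x.2] p = 0}

/-- `V` is a distinguished variety: a non-empty set that is the zero set in the bidisk of
a polynomial, and that exits the bidisk through the distinguished boundary. -/
def IsDistinguishedVariety (V : Set (ℂ × ℂ)) : Prop :=
  V.Nonempty ∧
    (∃ p : MvPolynomial (Fin 2) ℂ, V = bidisk ∩ zeroSet p) ∧
    closure V ∩ frontier bidisk = closure V ∩ torus

/-- `V` is the zero set of `p` in the bidisk, and the bidegree `(n, m)` of `p` is minimal
(for the componentwise order) among the polynomials with that zero set in the bidisk. -/
def IsMinimalDefining (V : Set (ℂ × ℂ)) (p : MvPolynomial (Fin 2) ℂ) : Prop :=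
  V = bidisk ∩ zeroSet p ∧
    ∀ q : MvPolynomial (Fin 2) ℂ, V = bidisk ∩ zeroSet q →
      q.degreeOf 0 ≤ p.degreeOf 0 → q.degreeOf 1 ≤ p.degreeOf 1 →
        q.degreeOf 0 = p.degreeOf 0 ∧ q.degreeOf 1 = p.degreeOf 1

/-- A polynomial defines a distinguished variety (in the global sense) if all its zeros in `ℂ²`
lie in the union of the bidisk, the two-torus and the square of the exterior disk. -/
def DefinesDistinguishedVariety (p : MvPolynomial (Fin 2) ℂ) : Prop :=
  zeroSet p ⊆ bidisk ∪ torus ∪ biexterior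

/-- Symmetry of a subset of `ℂ²` with respect to the two-torus. -/
def IsTorusSymmetric (S : Set (ℂ × ℂ)) : Prop :=
  ∀ z w : ℂ, z ≠ 0 → w ≠ 0 → ((z, w) ∈ S ↔ (1 / conj z, 1 / conj w) ∈ S)

/-- The reflection at the degree `(n, m)` of a polynomial of degree at most `(n, m)`: the
coefficient of `z ^ i * w ^ j` is conjugated and moved to `z ^ (n - i) * w ^ (m - j)`. The theorem
`eval_reflection` below identifies it with
`z ^ n * w ^ m * conj (q (1 / conj z, 1 / conj w))`. -/
noncomputable def reflection (n m : ℕ) (q : MvPolynomial (Fin 2) ℂ) : MvPolynomial (Fin 2) ℂ :=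
  ∑ s ∈ q.support, MvPolynomial.C (conj (q.coeff s)) *
    (MvPolynomial.X 0 ^ (n - s 0) * MvPolynomial.X 1 ^ (m - s 1))

theorem eval_reflection (n m : ℕ) (q : MvPolynomial (Fin 2) ℂ)
    (hn : q.degreeOf 0 ≤ n) (hm : q.degreeOf 1 ≤ m) (z w : ℂ) (hz : z ≠ 0) (hw : w ≠ 0) :
    MvPolynomial.eval ![z, w] (reflection n m q) =
      z ^ n * w ^ m * conj (MvPolynomial.eval ![1 / conj z, 1 / conj w] q) := by
  rw [reflection, map_sum, MvPolynomial.eval_eq' ![1 / conj z, 1 / conj w] q, map_sum,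
    Finset.mul_sum]
  refine Finset.sum_congr rfl fun s hs => ?_
  have h0 : s 0 ≤ n := (MvPolynomial.monomial_le_degreeOf 0 hs).trans hn
  have h1 : s 1 ≤ m := (MvPolynomial.monomial_le_degreeOf 1 hs).trans hm
  simp only [map_mul, MvPolynomial.eval_C, map_pow, MvPolynomial.eval_X, Fin.prod_univ_two,
    Matrix.cons_val_zero, Matrix.cons_val_one, map_div₀, map_one, Complex.conj_conj]
  rw [pow_sub₀ z hz h0, pow_sub₀ w hw h1]
  simp only [one_div, inv_pow]
  ring

/-- `p = c * p̃` for a unimodular constant `c`, the reflection `p̃` being taken at the degree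
of `p`. -/
def IsEssentiallyTorusSymmetric (p : MvPolynomial (Fin 2) ℂ) : Prop :=
  ∃ c : ℂ, ‖c‖ = 1 ∧
    p = MvPolynomial.C c * reflection (p.degreeOf 0) (p.degreeOf 1) p

end DistVar

namespace DistVar

open MvPolynomial Metric Filter Topology

/-! ### Common zeros of an irreducible polynomial -/

/-! Torus symmetry of the zero set is read off from $p = c\tilde p$. That identity holds for nonzero
constants and passes to products, so it suffices to prove it for each irreducible factor $q$ of $p$.
On $\mathbb{T}^2$ one has $|\tilde q| = |q|$, so torus zeros of $q$ are zeros of $\tilde q$. If they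
lie over infinitely many $w$, elimination gives $q \mid \tilde q$; since the degree of $\tilde q$ is
at most that of $q$, the quotient is a constant, of modulus 1
(`IsEssentiallyTorusSymmetric.of_irreducible`).

It remains to find torus zeros. In (1), minimality makes every factor vanish somewhere in
$\mathbb{D}^2$, and a Hurwitz argument excludes zeros of $q$ on $\mathbb{T}\times\mathbb{D}$ and
$\mathbb{D}\times\mathbb{T}$. By connectedness every $w \in \mathbb{D}$ then carries a zero in
$\mathbb{D}^2$, and by compactness every $w \in \mathbb{T}$ carries one on the torus. In (2), almost
every $w \in \mathbb{T}$ has a root $z$, which the hypothesis forces onto $\mathbb{T}$. -/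

theorem exists_mul_add_mul_eq_C_of_not_dvd {R : Type*} [CommRing R] [IsDomain R]
    [UniqueFactorizationMonoid R] {f g : Polynomial R} (hf : Irreducible f)
    (hd : f.natDegree ≠ 0) (hfg : ¬ f ∣ g) :
    ∃ (a b : Polynomial R) (r : R), r ≠ 0 ∧ f * a + g * b = Polynomial.C r := by
  let _ : NormalizedGCDMonoid R := Nonempty.some inferInstance
  let K := FractionRing R
  have hprim := hf.isPrimitive hd
  obtain ⟨a, b, -, -, h⟩ :=
    Polynomial.exists_mul_add_mul_eq_C_resultant f g le_rfl le_rfl (Or.inl hd)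
  -- A vanishing resultant gives a common factor over the fraction field; Gauss's lemma brings the
  -- divisibility back to `R`.
  refine ⟨a, b, _, fun h0 => hfg ?_, h⟩
  have hinj : Function.Injective (algebraMap R K) := IsFractionRing.injective R K
  have hres := Polynomial.resultant_map_map f g f.natDegree g.natDegree (algebraMap R K)
  rw [h0, map_zero] at hres
  have hirr := (hprim.irreducible_iff_irreducible_map_fraction_map (K := K)).1 hf
  have hnc : ¬ IsCoprime (f.map (algebraMap R K)) (g.map (algebraMap R K)) := by
    refine (Polynomial.resultant_eq_zero_iff.1 ?_).2
    rwa [Polynomial.natDegree_map_eq_of_injective hinj,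
      Polynomial.natDegree_map_eq_of_injective hinj]
  rw [hirr.coprime_iff_not_dvd, not_not] at hnc
  exact hprim.dvd_of_fraction_map_dvd_fraction_map (K := K) hnc

theorem eval_eq_eval_finSuccEquiv (p : MvPolynomial (Fin 2) ℂ) (z w : ℂ) :
    eval ![z, w] p = ((finSuccEquiv ℂ 1 p).map (eval ![w])).eval z :=
  eval_eq_eval_mv_eval' ![w] z p

theorem eq_zero_of_infinite_zeros {r : MvPolynomial (Fin 1) ℂ} {S : Set ℂ} (hS : S.Infinite)
    (h : ∀ w ∈ S, eval ![w] r = 0) : r = 0 := by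
  refine funext_set (fun _ => S) (fun _ => hS) fun x hx => ?_
  have hx' : x = ![x 0] := by
    ext i
    fin_cases i
    rfl
  rw [hx', h _ (hx 0 trivial), map_zero]

/-- If `q` does not divide `g`, eliminating $z$ gives a nonzero polynomial in $w$ alone, in the
ideal of `q` and `g`, which would vanish on `S`. If `q` is free of $z$, it is itself such a
polynomial. -/
theorem dvd_of_infinite_common_zeros_snd {q g : MvPolynomial (Fin 2) ℂ} (hq : Irreducible q)
    {S : Set ℂ} (hS : S.Infinite)
    (h : ∀ w ∈ S, ∃ z, eval ![z, w] q = 0 ∧ eval ![z, w] g = 0) : q ∣ g := by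
  have hf : Irreducible (finSuccEquiv ℂ 1 q) := (MulEquiv.irreducible_iff _).2 hq
  by_contra hqg
  have hfg : ¬ finSuccEquiv ℂ 1 q ∣ finSuccEquiv ℂ 1 g := fun hd =>
    hqg ((map_dvd_iff (finSuccEquiv ℂ 1)).1 hd)
  simp only [eval_eq_eval_finSuccEquiv] at h
  by_cases hd : (finSuccEquiv ℂ 1 q).natDegree = 0
  · rw [Polynomial.natDegree_eq_zero] at hd
    obtain ⟨r, hr⟩ := hd
    refine hf.ne_zero ?_
    rw [← hr, eq_zero_of_infinite_zeros (r := r) hS, map_zero]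
    intro w hw
    obtain ⟨z, hz, -⟩ := h w hw
    simpa [← hr] using hz
  · obtain ⟨a, b, r, hr, hab⟩ := exists_mul_add_mul_eq_C_of_not_dvd hf hd hfg
    refine hr (eq_zero_of_infinite_zeros hS fun w hw => ?_)
    obtain ⟨z, hz, hz'⟩ := h w hw
    have := congrArg (fun t => (t.map (eval ![w])).eval z) hab
    simpa [hz, hz'] using this.symm

theorem eval_rename_swap (p : MvPolynomial (Fin 2) ℂ) (z w : ℂ) :
    eval ![w, z] (renameEquiv ℂ (Equiv.swap (0 : Fin 2) 1) p) = eval ![z, w] p := by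
  rw [renameEquiv_apply, eval_rename]
  congr 2
  ext i
  fin_cases i <;> simp

theorem dvd_of_infinite_common_zeros_fst {q g : MvPolynomial (Fin 2) ℂ} (hq : Irreducible q)
    {S : Set ℂ} (hS : S.Infinite)
    (h : ∀ z ∈ S, ∃ w, eval ![z, w] q = 0 ∧ eval ![z, w] g = 0) : q ∣ g := by
  rw [← map_dvd_iff (renameEquiv ℂ (Equiv.swap (0 : Fin 2) 1))]
  refine dvd_of_infinite_common_zeros_snd ((MulEquiv.irreducible_iff _).2 hq) hS ?_
  simpa only [eval_rename_swap] using h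

/-! ### The reflection -/

theorem infinite_circle : circle.Infinite := by
  have hc : circle = sphere (0 : ℂ) 1 := by
    ext z
    simp [circle]
  rw [hc]
  refine (isPreconnected_sphere (by simp [Complex.rank_real_complex]) 0 1).infinite_of_nontrivial
    ⟨1, by simp, -1, by simp, by norm_num⟩

theorem ne_zero_of_mem_circle {z : ℂ} (hz : z ∈ circle) : z ≠ 0 := by
  rintro rfl
  simp [circle] at hz

theorem one_div_conj_of_mem_circle {z : ℂ} (hz : z ∈ circle) : 1 / conj z = z := by
  have hz0 : conj z ≠ 0 := by simpa using ne_zero_of_mem_circle hz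
  rw [div_eq_iff hz0, Complex.mul_conj', show ‖z‖ = 1 from hz]
  norm_num

theorem eq_of_eval_torus {p q : MvPolynomial (Fin 2) ℂ}
    (h : ∀ z ∈ circle, ∀ w ∈ circle, eval ![z, w] p = eval ![z, w] q) : p = q := by
  refine funext_set (fun _ => circle) (fun _ => infinite_circle) fun x hx => ?_
  have hx' : x = ![x 0, x 1] := by
    ext i
    fin_cases i <;> rfl
  rw [hx']
  exact h _ (hx 0 trivial) _ (hx 1 trivial)

theorem eval_reflection_torus (p : MvPolynomial (Fin 2) ℂ) {z w : ℂ}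
    (hz : z ∈ circle) (hw : w ∈ circle) :
    eval ![z, w] (reflection (p.degreeOf 0) (p.degreeOf 1) p) =
      z ^ p.degreeOf 0 * w ^ p.degreeOf 1 * conj (eval ![z, w] p) := by
  rw [eval_reflection _ _ p le_rfl le_rfl z w (ne_zero_of_mem_circle hz)
    (ne_zero_of_mem_circle hw), one_div_conj_of_mem_circle hz, one_div_conj_of_mem_circle hw]

theorem norm_eval_reflection_torus (p : MvPolynomial (Fin 2) ℂ) {z w : ℂ}
    (hz : z ∈ circle) (hw : w ∈ circle) :
    ‖eval ![z, w] (reflection (p.degreeOf 0) (p.degreeOf 1) p)‖ = ‖eval ![z, w] p‖ := by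
  rw [eval_reflection_torus p hz hw, norm_mul, norm_mul, norm_pow, norm_pow,
    show ‖z‖ = 1 from hz, show ‖w‖ = 1 from hw, Complex.norm_conj]
  simp

/-- Degrees add, so both sides agree on the torus, which determines a polynomial. -/
theorem reflection_mul {p q : MvPolynomial (Fin 2) ℂ} (hp : p ≠ 0) (hq : q ≠ 0) :
    reflection ((p * q).degreeOf 0) ((p * q).degreeOf 1) (p * q) =
      reflection (p.degreeOf 0) (p.degreeOf 1) p * reflection (q.degreeOf 0) (q.degreeOf 1) q := by
  refine eq_of_eval_torus fun z hz w hw => ?_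
  rw [map_mul, eval_reflection_torus _ hz hw, eval_reflection_torus _ hz hw,
    eval_reflection_torus _ hz hw, degreeOf_mul_eq hp hq, degreeOf_mul_eq hp hq, map_mul, map_mul]
  ring

theorem degreeOf_reflection_le (n m : ℕ) (q : MvPolynomial (Fin 2) ℂ) :
    (reflection n m q).degreeOf 0 ≤ n ∧ (reflection n m q).degreeOf 1 ≤ m := by
  have h01 (k : ℕ) : degreeOf 0 ((X 1 : MvPolynomial (Fin 2) ℂ) ^ k) = 0 := by
    exact degreeOf_X_pow_of_ne k (by decide)
  have h10 (k : ℕ) : degreeOf 1 ((X 0 : MvPolynomial (Fin 2) ℂ) ^ k) = 0 := by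
    exact degreeOf_X_pow_of_ne k (by decide)
  have hX (i : Fin 2) (k : ℕ) : degreeOf i ((X i : MvPolynomial (Fin 2) ℂ) ^ k) = k := by
    simp
  constructor <;> refine (degreeOf_sum_le _ _ _).trans (Finset.sup_le fun s _ => ?_) <;>
    refine (degreeOf_C_mul_le _ _ _).trans ((degreeOf_mul_le _ _ _).trans ?_)
  · rw [h01, hX]; omega
  · rw [h10, hX]; omega

theorem exists_eq_C_of_degreeOf_eq_zero {p : MvPolynomial (Fin 2) ℂ}
    (h0 : p.degreeOf 0 = 0) (h1 : p.degreeOf 1 = 0) : ∃ c, p = C c := by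
  refine ⟨_, totalDegree_eq_zero_iff_eq_C.1 ((totalDegree_eq_zero_iff _ _).2 fun m hm i => ?_)⟩
  fin_cases i
  · exact Nat.le_zero.1 ((monomial_le_degreeOf 0 hm).trans h0.le)
  · exact Nat.le_zero.1 ((monomial_le_degreeOf 1 hm).trans h1.le)

theorem IsEssentiallyTorusSymmetric.of_irreducible {q : MvPolynomial (Fin 2) ℂ}
    (hq : Irreducible q) {S : Set ℂ} (hS : S.Infinite) (hSc : S ⊆ circle)
    (h : ∀ w ∈ S, ∃ z ∈ circle, eval ![z, w] q = 0) : IsEssentiallyTorusSymmetric q := by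
  -- Comparing norms at this point shows that the quotient is nonzero and, once constant,
  -- unimodular.
  obtain ⟨z, hz, w, hw, hzw⟩ : ∃ z ∈ circle, ∃ w ∈ circle, eval ![z, w] q ≠ 0 := by
    by_contra! hcon
    exact hq.ne_zero (eq_of_eval_torus fun z hz w hw => by rw [hcon z hz w hw, map_zero])
  have hdvd : q ∣ reflection (q.degreeOf 0) (q.degreeOf 1) q := by
    refine dvd_of_infinite_common_zeros_snd hq hS fun w hw => ?_
    obtain ⟨z, hz, h0⟩ := h w hw
    exact ⟨z, h0, by rw [eval_reflection_torus q hz (hSc hw), h0, map_zero, mul_zero]⟩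
  obtain ⟨r, hr⟩ := hdvd
  have hnorm := norm_eval_reflection_torus q hz hw
  have hr0 : r ≠ 0 := by
    rintro rfl
    rw [hr, mul_zero, map_zero, norm_zero] at hnorm
    exact hzw (norm_eq_zero.1 hnorm.symm)
  obtain ⟨d0, d1⟩ := degreeOf_reflection_le (q.degreeOf 0) (q.degreeOf 1) q
  rw [hr, degreeOf_mul_eq hq.ne_zero hr0] at d0 d1
  obtain ⟨c, rfl⟩ := exists_eq_C_of_degreeOf_eq_zero (p := r) (by omega) (by omega)
  have hc : ‖c‖ = 1 := by
    rw [hr, map_mul, eval_C, norm_mul] at hnorm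
    exact (mul_eq_left₀ (norm_ne_zero_iff.2 hzw)).1 hnorm
  refine ⟨c⁻¹, by rw [norm_inv, hc, inv_one], ?_⟩
  have hc0 : c ≠ 0 := norm_ne_zero_iff.1 (by rw [hc]; exact one_ne_zero)
  rw [hr, mul_left_comm, ← map_mul, inv_mul_cancel₀ hc0, map_one, mul_one]

theorem isEssentiallyTorusSymmetric_C {a : ℂ} (ha : a ≠ 0) :
    IsEssentiallyTorusSymmetric (C a) := by
  have ha' : conj a ≠ 0 := by simpa using ha
  refine ⟨a / conj a, ?_, eq_of_eval_torus fun z hz w hw => ?_⟩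
  · rw [norm_div, Complex.norm_conj, div_self (norm_ne_zero_iff.2 ha)]
  · rw [map_mul, eval_reflection_torus _ hz hw]
    simp [ha']

theorem IsEssentiallyTorusSymmetric.mul {p q : MvPolynomial (Fin 2) ℂ} (hp0 : p ≠ 0)
    (hq0 : q ≠ 0) (hp : IsEssentiallyTorusSymmetric p) (hq : IsEssentiallyTorusSymmetric q) :
    IsEssentiallyTorusSymmetric (p * q) := by
  obtain ⟨c, hc, hpc⟩ := hp
  obtain ⟨d, hd, hqd⟩ := hq
  refine ⟨c * d, by rw [norm_mul, hc, hd, one_mul], ?_⟩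
  rw [reflection_mul hp0 hq0, map_mul, mul_mul_mul_comm, ← hpc, ← hqd]

theorem isEssentiallyTorusSymmetric_of_irreducible_factors (p : MvPolynomial (Fin 2) ℂ)
    (hp : p ≠ 0) (h : ∀ q, Irreducible q → q ∣ p → IsEssentiallyTorusSymmetric q) :
    IsEssentiallyTorusSymmetric p := by
  induction p using WfDvdMonoid.induction_on_irreducible with
  | zero => exact absurd rfl hp
  | unit u hu =>
    obtain ⟨a, ha, rfl⟩ := isUnit_iff_eq_C_of_isReduced.1 hu
    exact isEssentiallyTorusSymmetric_C ha.ne_zero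
  | mul a i ha hi ih =>
    exact (h i hi (dvd_mul_right _ _)).mul hi.ne_zero ha
      (ih ha fun q hq hqa => h q hq (hqa.mul_left _))

theorem IsEssentiallyTorusSymmetric.isTorusSymmetric {p : MvPolynomial (Fin 2) ℂ}
    (hp : IsEssentiallyTorusSymmetric p) : IsTorusSymmetric (zeroSet p) := by
  obtain ⟨c, hc, hpc⟩ := hp
  intro z w hz hw
  have hc0 : c ≠ 0 := norm_ne_zero_iff.1 (by rw [hc]; exact one_ne_zero)
  have h := congrArg (eval ![z, w]) hpc
  rw [map_mul, eval_C, eval_reflection _ _ p le_rfl le_rfl z w hz hw] at h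
  change eval ![z, w] p = 0 ↔ eval ![1 / conj z, 1 / conj w] p = 0
  rw [h]
  simp [hc0, hz, hw]


/-! ### Stability of zeros -/

/-- Hurwitz's theorem, via a quantitative open mapping theorem on a small circle around the isolated
zero `b₀`. -/
theorem eventually_exists_zero_near {F : ℂ → ℂ → ℂ} (hF : Continuous (Function.uncurry F))
    (hd : ∀ a, Differentiable ℂ (F a)) {a₀ b₀ : ℂ} (h0 : F a₀ b₀ = 0) (hne : ∃ b, F a₀ b ≠ 0)
    {ε : ℝ} (hε : 0 < ε) : ∀ᶠ a in 𝓝 a₀, ∃ b ∈ ball b₀ ε, F a b = 0 := by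
  have han (a : ℂ) : AnalyticOnNhd ℂ (F a) Set.univ := fun b _ => (hd a).analyticAt b
  have hisol : ∀ᶠ b in 𝓝[≠] b₀, F a₀ b ≠ 0 := by
    refine (han a₀ b₀ trivial).eventually_eq_zero_or_eventually_ne_zero.resolve_left fun h => ?_
    obtain ⟨b, hb⟩ := hne
    exact hb (congrFun ((han a₀).eq_of_eventuallyEq analyticOnNhd_const h) b)
  rw [eventually_nhdsWithin_iff, Metric.eventually_nhds_iff] at hisol
  obtain ⟨δ, hδ, hball⟩ := hisol
  obtain ⟨r, hr, hrlt⟩ := exists_between (lt_min hδ hε)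
  have hsph : ∀ b ∈ sphere b₀ r, F a₀ b ≠ 0 := fun b hb =>
    hball (by rw [mem_sphere.1 hb]; exact hrlt.trans_le (min_le_left _ _))
      (ne_of_mem_sphere hb hr.ne')
  have hc1 (b : ℂ) : Continuous fun a => F a b := hF.comp (by fun_prop : Continuous fun a => (a, b))
  -- The image of the closed ball contains the ball around `F a b₀` of half the minimum of the right
  -- side; the factor 2 puts 0 inside it.
  have hev : ∀ᶠ a in 𝓝 a₀, ∀ b ∈ sphere b₀ r, 2 * ‖F a b₀‖ < ‖F a b - F a b₀‖ := by
    refine (isCompact_sphere b₀ r).eventually_forall_of_forall_eventually fun b hb => ?_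
    have h1 : Continuous fun x : ℂ × ℂ => 2 * ‖F x.1 b₀‖ :=
      continuous_const.mul ((hc1 b₀).comp continuous_fst).norm
    have h2 : Continuous fun x : ℂ × ℂ => ‖F x.1 x.2 - F x.1 b₀‖ :=
      (hF.sub ((hc1 b₀).comp continuous_fst)).norm
    refine h1.continuousAt.eventually_lt h2.continuousAt ?_
    simpa [h0] using hsph b hb
  filter_upwards [hev] with a ha
  have hsne : (sphere b₀ r).Nonempty := (NormedSpace.sphere_nonempty (x := b₀)).2 hr.le
  obtain ⟨m, hm, hmin⟩ := (isCompact_sphere b₀ r).exists_isMinOn hsne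
    (f := fun b => ‖F a b - F a b₀‖) ((hd a).continuous.sub continuous_const).norm.continuousOn
  have hsub := DiffContOnCl.ball_subset_image_closedBall (hd a).diffContOnCl hr
    (fun b hb => isMinOn_iff.1 hmin b hb) (by
      by_contra hcon
      simp only [not_frequently, not_not] at hcon
      have hconst := (han a).eq_of_eventuallyEq analyticOnNhd_const hcon
      have := ha m hm
      rw [congrFun hconst m, sub_self, norm_zero] at this
      linarith [norm_nonneg (F a b₀)])
  obtain ⟨b, hb, hb0⟩ := hsub (show (0 : ℂ) ∈ _ by
    rw [mem_ball, dist_zero_left]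
    linarith [ha m hm])
  exact ⟨b, closedBall_subset_ball (hrlt.trans_le (min_le_right _ _)) hb, hb0⟩

theorem exists_zero_near_of_norm_eq_one {F : ℂ → ℂ → ℂ} (hF : Continuous (Function.uncurry F))
    (hd : ∀ a, Differentiable ℂ (F a)) {a₀ b₀ : ℂ} (ha : ‖a₀‖ = 1) (hb : ‖b₀‖ < 1)
    (h0 : F a₀ b₀ = 0) (hne : ∃ b, F a₀ b ≠ 0) {ε : ℝ} (hε : 0 < ε) :
    ∃ a b, ‖a‖ < 1 ∧ ‖b‖ < 1 ∧ F a b = 0 ∧ dist a₀ a < ε ∧ dist b₀ b < ε := by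
  have hfreq : ∃ᶠ a in 𝓝 a₀, a ∈ ball (0 : ℂ) 1 := by
    rw [← mem_closure_iff_frequently, closure_ball _ one_ne_zero]
    simpa using ha.le
  obtain ⟨a, hlt, ⟨b, hbm, hab⟩, hdist⟩ := (hfreq.and_eventually
    ((eventually_exists_zero_near hF hd h0 hne (lt_min hε (sub_pos.2 hb))).and
      (ball_mem_nhds a₀ hε))).exists
  rw [mem_ball'] at hbm
  rw [dist_comm] at hdist
  refine ⟨a, b, by simpa using hlt, ?_, hab, hdist, hbm.trans_le (min_le_left _ _)⟩
  have h1 : dist b₀ b < 1 - ‖b₀‖ := hbm.trans_le (min_le_right _ _)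
  have h2 : ‖b‖ ≤ ‖b₀‖ + dist b₀ b := by
    rw [dist_comm, dist_eq_norm]
    simpa using norm_add_le b₀ (b - b₀)
  linarith

/-- The set `U` of parameters in the disk with a zero in the disk is open by Hurwitz, and relatively
closed by compactness and `hDT`, so it is the whole disk. At a boundary parameter a limiting zero
survives, and `hTD` puts it on the circle. -/
theorem exists_zero_on_circle {F : ℂ → ℂ → ℂ} (hF : Continuous (Function.uncurry F))
    (hd : ∀ w, Differentiable ℂ (F w)) (hDT : ∀ w z, ‖w‖ < 1 → ‖z‖ = 1 → F w z ≠ 0)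
    (hTD : ∀ w z, ‖w‖ = 1 → ‖z‖ < 1 → F w z ≠ 0) {a b : ℂ} (ha : ‖a‖ < 1) (hb : ‖b‖ < 1)
    (hab : F a b = 0) {w : ℂ} (hw : ‖w‖ = 1) : ∃ z, ‖z‖ = 1 ∧ F w z = 0 := by
  let U : Set ℂ := {w | ‖w‖ < 1 ∧ ∃ z, ‖z‖ < 1 ∧ F w z = 0}
  have hU {w : ℂ} (h : w ∈ closure U) : ∃ z, ‖z‖ ≤ 1 ∧ F w z = 0 := by
    let K : Set (ℂ × ℂ) := (closedBall 0 1 ×ˢ closedBall 0 1) ∩ {x | Function.uncurry F x = 0}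
    have hK : IsCompact K := ((isCompact_closedBall 0 1).prod
      (isCompact_closedBall 0 1)).inter_right (isClosed_eq hF continuous_const)
    have hUK : closure U ⊆ Prod.fst '' K := by
      refine closure_minimal ?_ (hK.image continuous_fst).isClosed
      rintro w ⟨hw, z, hz, h0⟩
      exact ⟨(w, z), ⟨⟨by simpa using hw.le, by simpa using hz.le⟩, h0⟩, rfl⟩
    obtain ⟨⟨w', z⟩, ⟨⟨-, hz⟩, h0⟩, rfl⟩ := hUK h
    exact ⟨z, by simpa using hz, h0⟩
  have hUopen : IsOpen U := by
    rw [isOpen_iff_mem_nhds]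
    rintro w ⟨hw, z, hz, h0⟩
    have hdisk : ∀ᶠ w' in 𝓝 w, ‖w'‖ < 1 := continuous_norm.continuousAt.eventually_lt_const hw
    filter_upwards [hdisk, eventually_exists_zero_near hF hd h0 ⟨1, hDT w 1 hw norm_one⟩
      (sub_pos.2 hz)] with w' hw' hex
    obtain ⟨z', hz', h0'⟩ := hex
    refine ⟨hw', z', ?_, h0'⟩
    rw [mem_ball, dist_eq_norm] at hz'
    have : ‖z'‖ ≤ ‖z‖ + ‖z' - z‖ := by simpa using norm_add_le z (z' - z)
    linarith
  have hDU : ball (0 : ℂ) 1 ⊆ U := by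
    refine (convex_ball (0 : ℂ) 1).isPreconnected.subset_of_closure_inter_subset hUopen
      ⟨a, by simpa using ha, ha, b, hb, hab⟩ ?_
    rintro w ⟨hwU, hw⟩
    replace hw : ‖w‖ < 1 := by simpa using hw
    obtain ⟨z, hz, h0⟩ := hU hwU
    exact ⟨hw, z, hz.lt_of_ne fun h1 => hDT w z hw h1 h0, h0⟩
  have hwU : w ∈ closure U := by
    refine closure_mono hDU ?_
    rw [closure_ball _ one_ne_zero]
    simpa using hw.le
  obtain ⟨z, hz, h0⟩ := hU hwU
  exact ⟨z, hz.antisymm (not_lt.1 fun h1 => hTD w z hw h1 h0), h0⟩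

/-! ### Zeros on the torus -/

theorem continuous_eval_pair (p : MvPolynomial (Fin 2) ℂ) :
    Continuous fun x : ℂ × ℂ => eval ![x.1, x.2] p :=
  (continuous_eval p).comp (by fun_prop)

theorem differentiable_eval_fst (p : MvPolynomial (Fin 2) ℂ) (w : ℂ) :
    Differentiable ℂ fun z => eval ![z, w] p := by
  simp only [eval_eq_eval_finSuccEquiv]
  exact Polynomial.differentiable _

theorem differentiable_eval_snd (p : MvPolynomial (Fin 2) ℂ) (z : ℂ) :
    Differentiable ℂ fun w => eval ![z, w] p := by
  simpa only [eval_rename_swap] using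
    differentiable_eval_fst (renameEquiv ℂ (Equiv.swap (0 : Fin 2) 1) p) z

theorem bidisk_eq : bidisk = ball (0 : ℂ) 1 ×ˢ ball (0 : ℂ) 1 := by
  ext x
  simp [bidisk, disk]

theorem mem_bidisk_or_mem_torus {V W : Set (ℂ × ℂ)}
    (hV : closure V ∩ frontier bidisk = closure V ∩ torus) (hWV : W ⊆ V) (hW : W ⊆ bidisk)
    {x : ℂ × ℂ} (hx : x ∈ closure W) : x ∈ bidisk ∨ x ∈ torus := by
  by_cases hb : x ∈ bidisk
  · exact Or.inl hb
  · have ho : IsOpen bidisk := by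
      rw [bidisk_eq]
      exact isOpen_ball.prod isOpen_ball
    have hf : x ∈ frontier bidisk := by
      rw [ho.frontier_eq]
      exact ⟨closure_mono hW hx, hb⟩
    exact Or.inr (hV.subset ⟨closure_mono hWV hx, hf⟩).2

/-- An irreducible polynomial vanishing on a vertical line divides its equation, so it has no zero
off that line. This supplies the nondegeneracy needed for Hurwitz. -/
theorem exists_eval_ne_zero_snd {q : MvPolynomial (Fin 2) ℂ} (hq : Irreducible q)
    {a b : ℂ} (hab : eval ![a, b] q = 0) {z : ℂ} (hz : z ≠ a) : ∃ w, eval ![z, w] q ≠ 0 := by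
  by_contra! h
  obtain ⟨r, hr⟩ : q ∣ X 0 - C z :=
    dvd_of_infinite_common_zeros_snd hq Set.infinite_univ fun w _ => ⟨z, h w, by simp⟩
  have := congrArg (eval ![a, b]) hr
  rw [map_mul, hab, zero_mul] at this
  refine hz (sub_eq_zero.1 ?_).symm
  simpa using this

theorem exists_eval_ne_zero_fst {q : MvPolynomial (Fin 2) ℂ} (hq : Irreducible q)
    {a b : ℂ} (hab : eval ![a, b] q = 0) {w : ℂ} (hw : w ≠ b) : ∃ z, eval ![z, w] q ≠ 0 := by
  by_contra! h
  obtain ⟨r, hr⟩ : q ∣ X 1 - C w :=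
    dvd_of_infinite_common_zeros_fst hq Set.infinite_univ fun z _ => ⟨w, h z, by simp⟩
  have := congrArg (eval ![a, b]) hr
  rw [map_mul, hab, zero_mul] at this
  refine hw (sub_eq_zero.1 ?_).symm
  simpa using this

theorem mem_bidisk_inter_zeroSet {q : MvPolynomial (Fin 2) ℂ} {z w : ℂ} :
    (z, w) ∈ bidisk ∩ zeroSet q ↔ (‖z‖ < 1 ∧ ‖w‖ < 1) ∧ eval ![z, w] q = 0 :=
  Iff.rfl

theorem mem_closure_bidisk_inter_zeroSet {q : MvPolynomial (Fin 2) ℂ} {z w : ℂ}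
    (h : ∀ ε > 0, ∃ z' w', ‖z'‖ < 1 ∧ ‖w'‖ < 1 ∧ eval ![z', w'] q = 0 ∧
      dist z z' < ε ∧ dist w w' < ε) : (z, w) ∈ closure (bidisk ∩ zeroSet q) := by
  refine Metric.mem_closure_iff.2 fun ε hε => ?_
  obtain ⟨z', w', hz', hw', h0', hd, hd'⟩ := h ε hε
  refine ⟨(z', w'), mem_bidisk_inter_zeroSet.2 ⟨⟨hz', hw'⟩, h0'⟩, ?_⟩
  rw [Prod.dist_eq]
  exact max_lt hd hd'

theorem continuous_uncurry_eval (q : MvPolynomial (Fin 2) ℂ) :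
    Continuous (Function.uncurry fun z w : ℂ => eval ![z, w] q) :=
  continuous_eval_pair q

theorem continuous_uncurry_eval_swap (q : MvPolynomial (Fin 2) ℂ) :
    Continuous (Function.uncurry fun w z : ℂ => eval ![z, w] q) := by
  simpa only [Function.uncurry_def, Function.comp_def, Prod.fst_swap, Prod.snd_swap] using
    (continuous_eval_pair q).comp continuous_swap

/-- By Hurwitz such a zero would be a limit of zeros in the bidisk, yet it lies neither in the
bidisk nor on the torus. -/
theorem eval_ne_zero_of_norm_fst_eq_one {q : MvPolynomial (Fin 2) ℂ} (hq : Irreducible q)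
    (hcl : ∀ x ∈ closure (bidisk ∩ zeroSet q), x ∈ bidisk ∨ x ∈ torus) {a b : ℂ} (ha : ‖a‖ < 1)
    (hab : eval ![a, b] q = 0) {z w : ℂ} (hz : ‖z‖ = 1) (hw : ‖w‖ < 1) :
    eval ![z, w] q ≠ 0 := by
  intro h0
  have hza : z ≠ a := by
    rintro rfl
    exact ha.ne hz
  have hx := mem_closure_bidisk_inter_zeroSet fun ε hε =>
    exists_zero_near_of_norm_eq_one (continuous_uncurry_eval q) (differentiable_eval_snd q) hz hw h0
      (exists_eval_ne_zero_snd hq hab hza) hε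
  rcases hcl _ hx with h | h
  · exact (show ‖z‖ < 1 from h.1).ne hz
  · exact hw.ne h.2

theorem eval_ne_zero_of_norm_snd_eq_one {q : MvPolynomial (Fin 2) ℂ} (hq : Irreducible q)
    (hcl : ∀ x ∈ closure (bidisk ∩ zeroSet q), x ∈ bidisk ∨ x ∈ torus) {a b : ℂ} (hb : ‖b‖ < 1)
    (hab : eval ![a, b] q = 0) {z w : ℂ} (hz : ‖z‖ < 1) (hw : ‖w‖ = 1) :
    eval ![z, w] q ≠ 0 := by
  intro h0
  have hwb : w ≠ b := by
    rintro rfl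
    exact hb.ne hw
  have hx : (z, w) ∈ closure (bidisk ∩ zeroSet q) := by
    refine mem_closure_bidisk_inter_zeroSet fun ε hε => ?_
    obtain ⟨w', z', hw', hz', h0', hd, hd'⟩ := exists_zero_near_of_norm_eq_one
      (continuous_uncurry_eval_swap q) (differentiable_eval_fst q) hw hz h0
      (exists_eval_ne_zero_fst hq hab hwb) hε
    exact ⟨z', w', hz', hw', h0', hd', hd⟩
  rcases hcl _ hx with h | h
  · exact (show ‖w‖ < 1 from h.2).ne hw
  · exact hz.ne h.1

theorem exists_torus_zero {V : Set (ℂ × ℂ)}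
    (hV : closure V ∩ frontier bidisk = closure V ∩ torus) {q : MvPolynomial (Fin 2) ℂ}
    (hq : Irreducible q) (hqV : bidisk ∩ zeroSet q ⊆ V) (hne : (bidisk ∩ zeroSet q).Nonempty) :
    ∀ w ∈ circle, ∃ z ∈ circle, eval ![z, w] q = 0 := by
  obtain ⟨⟨a, b⟩, hmem⟩ := hne
  obtain ⟨⟨ha, hb⟩, hab⟩ := mem_bidisk_inter_zeroSet.1 hmem
  have hcl (x) (hx : x ∈ closure (bidisk ∩ zeroSet q)) : x ∈ bidisk ∨ x ∈ torus :=
    mem_bidisk_or_mem_torus hV hqV Set.inter_subset_left hx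
  intro w hw
  exact exists_zero_on_circle (continuous_uncurry_eval_swap q) (differentiable_eval_fst q)
    (fun _ _ hw hz => eval_ne_zero_of_norm_fst_eq_one hq hcl ha hab hz hw)
    (fun _ _ hw hz => eval_ne_zero_of_norm_snd_eq_one hq hcl hb hab hz hw) hb ha hab hw

/-! ### The two cases -/

/-- A factor without zeros in the bidisk can be cancelled without changing `V`; minimality then
gives it degree $(0,0)$, making it a unit. -/
theorem IsMinimalDefining.nonempty_of_irreducible {V : Set (ℂ × ℂ)}
    {p q : MvPolynomial (Fin 2) ℂ} (hp : IsMinimalDefining V p) (hp0 : p ≠ 0)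
    (hq : Irreducible q) (hqp : q ∣ p) : (bidisk ∩ zeroSet q).Nonempty := by
  by_contra hemp
  obtain ⟨r, rfl⟩ := hqp
  have hr0 : r ≠ 0 := right_ne_zero_of_mul hp0
  have hVr : V = bidisk ∩ zeroSet r := by
    rw [hp.1]
    ext x
    refine and_congr_right fun hx => ?_
    have hqx : eval ![x.1, x.2] q ≠ 0 := fun h => hemp ⟨x, hx, h⟩
    simp [zeroSet, hqx]
  have h0 := degreeOf_mul_eq (n := 0) hq.ne_zero hr0
  have h1 := degreeOf_mul_eq (n := 1) hq.ne_zero hr0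
  obtain ⟨e0, e1⟩ := hp.2 r hVr (by omega) (by omega)
  obtain ⟨c, rfl⟩ := exists_eq_C_of_degreeOf_eq_zero (p := q) (by omega) (by omega)
  have hc : c ≠ 0 := by
    rintro rfl
    exact hq.ne_zero (map_zero _)
  exact hq.not_isUnit (hc.isUnit.map C)

theorem IsDistinguishedVariety.ne_zero {V : Set (ℂ × ℂ)} (hV : IsDistinguishedVariety V)
    {p : MvPolynomial (Fin 2) ℂ} (hp : V = bidisk ∩ zeroSet p) : p ≠ 0 := by
  rintro rfl
  have hVb : V = bidisk := by
    rw [hp]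
    ext x
    simp [zeroSet]
  have hcl : ((1 : ℂ), (0 : ℂ)) ∈ closure bidisk := by
    rw [bidisk_eq, closure_prod_eq, closure_ball _ one_ne_zero]
    simp
  rcases mem_bidisk_or_mem_torus hV.2.2 hVb.ge subset_rfl hcl with h | h
  · exact absurd h.1 (by simp [disk])
  · exact absurd h.2 (by simp [circle])

/-- The weak Nullstellensatz for a principal ideal. -/
theorem isUnit_of_eval_ne_zero {q : MvPolynomial (Fin 2) ℂ}
    (h : ∀ z w, eval ![z, w] q ≠ 0) : IsUnit q := by
  have hloc : zeroLocus ℂ (Ideal.span {q}) = ∅ := by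
    refine Set.eq_empty_of_forall_notMem fun x hx => h (x 0) (x 1) ?_
    have hx' : ![x 0, x 1] = x := by
      ext i
      fin_cases i <;> rfl
    rw [hx']
    exact hx q (Ideal.mem_span_singleton_self q)
  have hrad := vanishingIdeal_zeroLocus_eq_radical (K := ℂ) (Ideal.span {q})
  rw [hloc, vanishingIdeal_empty] at hrad
  exact Ideal.span_singleton_eq_top.1 (Ideal.radical_eq_top.1 hrad.symm)

theorem DefinesDistinguishedVariety.exists_torus_zero {q : MvPolynomial (Fin 2) ℂ}
    (hq : Irreducible q) (hD : DefinesDistinguishedVariety q) :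
    ∃ S ⊆ circle, S.Infinite ∧ ∀ w ∈ S, ∃ z ∈ circle, eval ![z, w] q = 0 := by
  have hlc : (finSuccEquiv ℂ 1 q).leadingCoeff ≠ 0 := by
    simpa using hq.ne_zero
  have hdeg : (finSuccEquiv ℂ 1 q).natDegree ≠ 0 := by
    intro hd
    rw [Polynomial.natDegree_eq_zero] at hd
    obtain ⟨r, hr⟩ := hd
    have hindep (z w : ℂ) : eval ![z, w] q = eval ![w] r := by
      simp [eval_eq_eval_finSuccEquiv, ← hr]
    refine hq.not_isUnit (isUnit_of_eval_ne_zero fun z w h0 => ?_)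
    rw [hindep] at h0
    -- On a line of zeros with `w` fixed, $z = 0$ forces $|w| < 1$ and $z = 1$ forces $|w| = 1$.
    have h1 : (0, w) ∈ bidisk ∪ torus ∪ biexterior := hD ((hindep 0 w).trans h0)
    have h2 : (1, w) ∈ bidisk ∪ torus ∪ biexterior := hD ((hindep 1 w).trans h0)
    simp [bidisk, torus, biexterior, disk, circle, exterior] at h1 h2
    norm_num [h2] at h1
  refine ⟨{w ∈ circle | eval ![w] (finSuccEquiv ℂ 1 q).leadingCoeff ≠ 0}, fun w hw => hw.1, ?_, ?_⟩
  · intro hfin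
    refine hlc (eq_zero_of_infinite_zeros (infinite_circle.sdiff hfin) fun w hw => ?_)
    by_contra h
    exact hw.2 ⟨hw.1, h⟩
  · rintro w ⟨hw, hw0⟩
    have hdeg' : ((finSuccEquiv ℂ 1 q).map (eval ![w])).degree ≠ 0 := by
      rw [Polynomial.degree_map_eq_of_leadingCoeff_ne_zero _ hw0]
      exact fun h => hdeg (Polynomial.natDegree_eq_of_degree_eq_some h)
    obtain ⟨z, hz⟩ := IsAlgClosed.exists_root _ hdeg'
    have h0 : eval ![z, w] q = 0 := (eval_eq_eval_finSuccEquiv q z w).trans hz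
    have hzw : (z, w) ∈ bidisk ∪ torus ∪ biexterior := hD h0
    replace hw : ‖w‖ = 1 := hw
    simp [bidisk, torus, biexterior, disk, circle, exterior, hw] at hzw
    exact ⟨z, hzw, h0⟩

theorem IsMinimalDefining.isEssentiallyTorusSymmetric {V : Set (ℂ × ℂ)}
    {p : MvPolynomial (Fin 2) ℂ} (hV : IsDistinguishedVariety V) (hp : IsMinimalDefining V p) :
    IsEssentiallyTorusSymmetric p := by
  have hp0 := hV.ne_zero hp.1
  refine isEssentiallyTorusSymmetric_of_irreducible_factors p hp0 fun q hq hqp => ?_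
  refine .of_irreducible hq infinite_circle subset_rfl (DistVar.exists_torus_zero hV.2.2 hq ?_
    (hp.nonempty_of_irreducible hp0 hq hqp))
  rw [hp.1]
  exact Set.inter_subset_inter_right _ fun x hx =>
    zero_dvd_iff.1 (hx ▸ map_dvd (eval ![x.1, x.2]) hqp)

theorem DefinesDistinguishedVariety.isEssentiallyTorusSymmetric
    {p : MvPolynomial (Fin 2) ℂ} (hp : DefinesDistinguishedVariety p) :
    IsEssentiallyTorusSymmetric p := by
  have hp0 : p ≠ 0 := by
    rintro rfl
    have h : ((0 : ℂ), (1 : ℂ)) ∈ bidisk ∪ torus ∪ biexterior := hp (by simp [zeroSet])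
    simp [bidisk, torus, biexterior, disk, circle, exterior] at h
  refine isEssentiallyTorusSymmetric_of_irreducible_factors p hp0 fun q hq hqp => ?_
  have hq' : DefinesDistinguishedVariety q := fun x hx =>
    hp (zero_dvd_iff.1 (hx ▸ map_dvd (eval ![x.1, x.2]) hqp))
  obtain ⟨S, hSc, hS, h⟩ := hq'.exists_torus_zero hq
  exact .of_irreducible hq hS hSc h

end DistVar

theorem mainTheorem8 :
    (∀ (V : Set (ℂ × ℂ)) (p : MvPolynomial (Fin 2) ℂ),
      DistVar.IsDistinguishedVariety V → DistVar.IsMinimalDefining V p →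
        DistVar.IsTorusSymmetric (DistVar.zeroSet p) ∧
          DistVar.IsEssentiallyTorusSymmetric p) ∧
    (∀ p : MvPolynomial (Fin 2) ℂ, DistVar.DefinesDistinguishedVariety p →
      DistVar.IsTorusSymmetric (DistVar.zeroSet p) ∧
        DistVar.IsEssentiallyTorusSymmetric p) := by
  refine ⟨fun V p hV hp => ?_, fun p hp => ?_⟩
  · have h := hp.isEssentiallyTorusSymmetric hV
    exact ⟨h.isTorusSymmetric, h⟩
  · have h := hp.isEssentiallyTorusSymmetric
    exact ⟨h.isTorusSymmetric, h⟩
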